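/- Let $n\ge 1$, $[n]=\{1,\dots,n\}$, and let $h:[n]\to[n]$ be a Hessenberg function, i.e. $h(i-1)\le h(i)$ for $2\le i\le n$ and $h(i)\ge i$ for all $i$; set $h(0)=0$. Call $i\in[n]$ a corner of $h$ if $h(i)>h(i-1)$; its corner box is the box $(h(i),i)$ (row $h(i)$, column $i$) of the diagram of $h$ in the $n\times n$ grid. Let $Z=(z_{ij})$ be the generic $n\times n$ matrix over $\mathbb{C}[\mathbf{z}]=\mathbb{C}[z_{ij}\mid i,j\in[n]]$, with columns $v_1,\dots,v_n$, and let $\mathsf{s}=\mathrm{diag}(1,0,\dots,0)$. For $i\in[n]$ let $\mathcal{I}_{\mathsf{s},h,i}\subseteq\mathbb{C}[\mathbf{z}]$ be $0$ if $h(i)=n$, and otherwise the ideal generated by all minors of size $h(i)+1$ of the $n\times(i+h(i))$ matrix $[\,\mathsf{s}v_1\ \cdots\ \mathsf{s}v_i\ \ v_1\ \cdots\ v_{h(i)}\,]$. Let $\mathcal{I}_{\mathsf{s},h}=\sum_{i\in[n]}\mathcal{I}_{\mathsf{s},h,i}$, let $\tilde{\mathcal{I}}_{\mathsf{s},h}$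 be the preimage in $\mathbb{C}[\mathbf{z}]$ of the ideal generated by $\mathcal{I}_{\mathsf{s},h}$ in the localization $\mathbb{C}[\mathbf{z},\det(Z)^{-1}]$, and let $\mathcal{Y}_{\mathsf{s},h}=\mathrm{Spec}(\mathbb{C}[\mathbf{z}]/\tilde{\mathcal{I}}_{\mathsf{s},h})$ be the minimal semisimple matrix Hessenberg scheme. Then $\mathcal{Y}_{\mathsf{s},h}$ is equidimensional (all its irreducible components have the same dimension) if and only if $h(i)-i=h(j)-j$ for all corners $i$ and $j$ of $h$. Equivalently, $\mathcal{Y}_{\mathsf{s},h}$ is equidimensional if and only if all corner boxes of the diagram of $h$ lie on one subdiagonal $\{(a,b)\in[n]\times[n]\mid a-b=k\}$, for some integer $k\ge 0$. -/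

import Mathlib

/-!
Throughout, `Fin n` plays the role of `[n] = {1, …, n}`: the element of `Fin n` with value `k`
stands for `k + 1`.
-/

/-- A function `h : [n] → [n]` is a Hessenberg function if `h(i - 1) ≤ h(i)` for all `i` and
`i ≤ h(i)` for all `i`. -/
structure IsHessenberg {n : ℕ} (h : Fin n → Fin n) : Prop where
  mono : ∀ i j : Fin n, (j : ℕ) + 1 = (i : ℕ) → h j ≤ h i
  le_apply : ∀ i : Fin n, i ≤ h i

/-- `i` is a corner of `h` if `h(i) > h(i - 1)`, with the convention `h(0) = 0`; so the first
index, which has no predecessor, is always a corner. -/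
def IsHessenbergCorner {n : ℕ} (h : Fin n → Fin n) (i : Fin n) : Prop :=
  ∀ j : Fin n, (j : ℕ) + 1 = (i : ℕ) → h j < h i

/-- The corner boxes `(h(i), i)` (row, column) of the diagram of `h`, for `i` a corner of `h`. -/
def cornerBoxes {n : ℕ} (h : Fin n → Fin n) : Set (Fin n × Fin n) :=
  {p | ∃ i : Fin n, IsHessenbergCorner h i ∧ p = (h i, i)}

/-- The `k`-th subdiagonal of the `n × n` grid: the boxes `(a, b)` with `a - b = k`
(for `k = 0` this is the main diagonal). -/
def subdiagonal (n k : ℕ) : Set (Fin n × Fin n) :=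
  {p | (p.1 : ℤ) - (p.2 : ℤ) = (k : ℤ)}

/-- The ideal generated by all `k × k` minors of a matrix. -/
def minorsIdeal {R α β : Type*} [CommRing R] (k : ℕ) (M : Matrix α β R) : Ideal R :=
  Ideal.span {f : R | ∃ (r : Fin k ↪ α) (c : Fin k ↪ β), f = (M.submatrix r c).det}

/-- The coordinate ring `ℂ[z]` of the space of `n × n` matrices. -/
abbrev MatCoordRing (n : ℕ) : Type := MvPolynomial (Fin n × Fin n) ℂ

/-- The generic matrix `Z = (z_{ij})`. -/
noncomputable abbrev genericMatrix (n : ℕ) : Matrix (Fin n) (Fin n) (MatCoordRing n) :=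
  Matrix.mvPolynomialX (Fin n) (Fin n) ℂ

/-- The matrix `[x v_1 ⋯ x v_i | v_1 ⋯ v_{h(i)}]`, where `v_j` is the `j`-th column of `Z`. -/
noncomputable def hessenbergMatrix {n : ℕ} (x : Matrix (Fin n) (Fin n) ℂ) (h : Fin n → Fin n)
    (i : Fin n) :
    Matrix (Fin n) ({j : Fin n // j ≤ i} ⊕ {j : Fin n // j ≤ h i}) (MatCoordRing n) :=
  Matrix.fromCols
    (Matrix.of fun a j => (x.map MvPolynomial.C * genericMatrix n : Matrix _ _ _) a j.1)
    (Matrix.of fun a j => genericMatrix n a j.1)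

open Classical in
/-- The ideal `I_{x,h,i}`: zero if `h(i) = n`, and otherwise the ideal of all minors of size
`h(i) + 1` of the matrix above. As `h i : Fin n` stands for the number `(h i : ℕ) + 1`, these
minors have size `(h i : ℕ) + 2`. -/
noncomputable def hessenbergIdealAt {n : ℕ} (x : Matrix (Fin n) (Fin n) ℂ) (h : Fin n → Fin n)
    (i : Fin n) : Ideal (MatCoordRing n) :=
  if (h i : ℕ) + 1 = n then ⊥ else minorsIdeal ((h i : ℕ) + 2) (hessenbergMatrix x h i)

/-- The ideal `I_{x,h}`, the sum of the ideals `I_{x,h,i}` over all `i`. -/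
noncomputable def hessenbergIdeal {n : ℕ} (x : Matrix (Fin n) (Fin n) ℂ) (h : Fin n → Fin n) :
    Ideal (MatCoordRing n) :=
  ⨆ i : Fin n, hessenbergIdealAt x h i

/-- The preimage in `ℂ[z]` of the extension of `I` to the coordinate ring `ℂ[z, det(Z)⁻¹]` of
`GL_n(ℂ)`. -/
noncomputable def detSaturation {n : ℕ} (I : Ideal (MatCoordRing n)) : Ideal (MatCoordRing n) :=
  (I.map (algebraMap (MatCoordRing n) (Localization.Away (genericMatrix n).det))).comap
    (algebraMap (MatCoordRing n) (Localization.Away (genericMatrix n).det))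

/-- The matrix Hessenberg scheme of `x` and `h`. -/
noncomputable def matrixHessenbergScheme {n : ℕ} (x : Matrix (Fin n) (Fin n) ℂ)
    (h : Fin n → Fin n) : AlgebraicGeometry.Scheme.{0} :=
  AlgebraicGeometry.Spec (CommRingCat.of (MatCoordRing n ⧸ detSaturation (hessenbergIdeal x h)))

/-- The minimal semisimple matrix `s = diag(1, 0, …, 0)`. -/
def minimalSemisimple (n : ℕ) : Matrix (Fin n) (Fin n) ℂ :=
  Matrix.diagonal fun i => if (i : ℕ) = 0 then 1 else 0

/-- A scheme is equidimensional if all its irreducible components have the same dimension. -/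
def IsEquidimensional (X : AlgebraicGeometry.Scheme.{0}) : Prop :=
  ∀ Z ∈ irreducibleComponents X, ∀ Z' ∈ irreducibleComponents X,
    topologicalKrullDim Z = topologicalKrullDim Z'

/-!
Only the underlying topological space of the scheme matters. Over a field `K`, let `Z` be invertible
with first row `a`, and let `b = Z⁻¹ e₁`. As `s v_j = a_j e₁`, the matrix
`[s v_1 ⋯ s v_i | v_1 ⋯ v_{h(i)}]` has rank at most `h(i)` if and only if `a_1 = ⋯ = a_i = 0` or
`b_k = 0` for all `k > h(i)`. If `r` is the first index with `a_r ≠ 0`, all these conditions together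
say that `b` is supported in the indices `≤ h(r)` (`IsComponentPoint.hessenbergIdeal_le_ker`,
`exists_isComponentPoint`). So the scheme is the union of the closures of the sets `Y_r` of invertible
matrices given by `a_j = 0` for `j < r` and `b_k = 0` for `k > h(r)`, and by monotonicity of `h` it
suffices to let `r` run through the corners.

Each `Y_r` has the same closure as the image of an affine space: choose the entries of the first row
in the columns `≥ r`, the `b_k` with `k ≤ h(r)`, `k ≠ r`, normalized by `b_r = 1`, and all entries
below the first row outside of the column `r`; the equation `Z b ∈ ⟨e₁⟩` gives the column `r`
(`componentMatrix`). The kernel `componentIdeal r (h r)` of this parametrization is prime, and a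
point of `Y_r` with `b_r = 0`, which the parametrization misses, is a limit of points that it reaches
(`IsComponentPoint.componentIdeal_le_ker`). The ideals of different corners are not contained in each
other, because they are told apart by the `z_{1j}` and by the entries in the first column of the
adjugate matrix that they contain (`le_of_componentIdeal_le`). Hence they are the minimal primes.

The parametrization is generically finite, since by Cramer's rule the `b_k` are rational functions of
the entries of `Z`. So the dimension of `Y_r` is the number of parameters, which is `h(r) - r` plus a
constant (`ringKrullDim_quotient_componentIdeal`, `card_componentParam_add`). This rests on the
equality of Krull dimension and transcendence degree for finitely generated domains, a consequence
of Noether normalization.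
-/

/-! ### Krull dimension of finitely generated domains -/

theorem Algebra.IsIntegral.ringKrullDim_eq {R S : Type*} [CommRing R] [CommRing S] [Algebra R S]
    [Algebra.IsIntegral R S] [FaithfulSMul R S] : ringKrullDim S = ringKrullDim R := by
  apply le_antisymm
  · -- incomparability: contraction is strictly monotone on primes
    refine Order.krullDim_le_of_strictMono (PrimeSpectrum.comap (algebraMap R S)) ?_
    intro p q hpq
    have := p.isPrime
    exact Ideal.IsIntegral.comap_lt_comap (R := R) (I := p.asIdeal) (J := q.asIdeal) hpq
  · -- going up: every chain of primes lifts
    refine iSup_le fun l => ?_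
    obtain ⟨P, hP⟩ := Algebra.IsIntegral.comap_surjective (R := R) (S := S) l.head
    have : P.asIdeal.LiesOver l.head.asIdeal := ⟨by rw [← hP]; rfl⟩
    obtain ⟨L, hL, -⟩ := Ideal.exists_ltSeries_of_hasGoingUp (S := S) l P.asIdeal
    rw [← hL]
    exact Order.LTSeries.length_le_krullDim L

theorem ringKrullDim_eq_trdeg_of_finiteType (k A : Type) [Field k] [CommRing A] [IsDomain A]
    [Algebra k A] [Algebra.FiniteType k A] {d : ℕ} (hd : Algebra.trdeg k A = d) :
    ringKrullDim A = d := by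
  obtain ⟨s, g, hinj, hint⟩ := exists_integral_inj_algHom_of_fg k A
  algebraize [g.toRingHom]
  have : IsScalarTower k (MvPolynomial (Fin s) k) A := .of_algebraMap_eq' g.comp_algebraMap.symm
  have hfaith : FaithfulSMul (MvPolynomial (Fin s) k) A :=
    (faithfulSMul_iff_algebraMap_injective _ _).mpr hinj
  have hs : Algebra.trdeg k A = s := by
    have h := lift_trdeg_add_eq k (MvPolynomial (Fin s) k) A
    rw [trdeg_eq_zero (R := MvPolynomial (Fin s) k) (A := A)] at h
    simpa using h.symm
  have : s = d := by exact_mod_cast hs.symm.trans hd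
  rw [Algebra.IsIntegral.ringKrullDim_eq (R := MvPolynomial (Fin s) k),
    MvPolynomial.ringKrullDim_of_isNoetherianRing, ringKrullDim_eq_zero_of_field]
  simp [this]

/-- The closure of the image of a generically finite polynomial map has the dimension of the source. -/
theorem ringKrullDim_quotient_ker_eq_card {k ι σ : Type} [Field k] [Finite ι] [Fintype σ]
    (φ : MvPolynomial ι k →ₐ[k] MvPolynomial σ k)
    (hφ : ∀ s, IsAlgebraic φ.range (MvPolynomial.X s : MvPolynomial σ k)) :
    ringKrullDim (MvPolynomial ι k ⧸ RingHom.ker φ) = Fintype.card σ := by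
  have halg : Algebra.IsAlgebraic φ.range (MvPolynomial σ k) := by
    have htop : ∀ p : MvPolynomial σ k,
        p ∈ (Subalgebra.algebraicClosure φ.range (MvPolynomial σ k)) := by
      intro p
      induction p using MvPolynomial.induction_on with
      | C a =>
        exact isAlgebraic_algebraMap (⟨MvPolynomial.C a, ⟨MvPolynomial.C a, by simp⟩⟩ : φ.range)
      | add p q hp hq => exact add_mem hp hq
      | mul_X p s hp => exact mul_mem hp (hφ s)
    exact ⟨fun p => htop p⟩
  have htr : Algebra.trdeg k φ.range = (Fintype.card σ : ℕ) := by
    have h := lift_trdeg_add_eq k φ.range (MvPolynomial σ k)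
    rw [trdeg_eq_zero (R := φ.range) (A := MvPolynomial σ k)] at h
    simpa using h
  have hfin : Algebra.FiniteType k φ.range :=
    Algebra.FiniteType.of_surjective φ.rangeRestrict φ.rangeRestrict_surjective
  rw [ringKrullDim_eq_of_ringEquiv (Ideal.quotientKerEquivRange φ).toRingEquiv]
  exact ringKrullDim_eq_trdeg_of_finiteType k φ.range htr

/-! ### Irreducible components of an affine scheme -/

theorem PrimeSpectrum.topologicalKrullDim_zeroLocus {R : Type*} [CommRing R] (I : Ideal R) :
    topologicalKrullDim (PrimeSpectrum.zeroLocus (I : Set R)) = ringKrullDim (R ⧸ I) := by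
  rw [← PrimeSpectrum.topologicalKrullDim_eq_ringKrullDim]
  have he := PrimeSpectrum.isEmbedding_comap_of_surjective (R := R) (R ⧸ I) _
    (Ideal.Quotient.mk_surjective (I := I))
  have hr := range_comap_of_surjective (R := R) (R ⧸ I) _
    (Ideal.Quotient.mk_surjective (I := I))
  rw [Ideal.mk_ker] at hr
  rw [← hr]
  exact (IsHomeomorph.topologicalKrullDim_eq _ he.toHomeomorph.isHomeomorph).symm

theorem isEquidimensional_Spec_quotient_iff {R : Type} [CommRing R] (J : Ideal R) :
    IsEquidimensional (AlgebraicGeometry.Spec (CommRingCat.of (R ⧸ J))) ↔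
      ∀ p ∈ J.minimalPrimes, ∀ q ∈ J.minimalPrimes, ringKrullDim (R ⧸ p) = ringKrullDim (R ⧸ q) := by
  have hsurj := Ideal.Quotient.mk_surjective (I := J)
  have hmin : J.minimalPrimes = Ideal.comap (Ideal.Quotient.mk J) '' minimalPrimes (R ⧸ J) := by
    have h := Ideal.comap_minimalPrimes_eq_of_surjective hsurj ⊥
    rwa [← RingHom.ker_eq_comap_bot, Ideal.mk_ker] at h
  have hdim (p : Ideal (R ⧸ J)) : topologicalKrullDim (PrimeSpectrum.zeroLocus (p : Set (R ⧸ J))) =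
      ringKrullDim (R ⧸ p.comap (Ideal.Quotient.mk J)) := by
    rw [PrimeSpectrum.topologicalKrullDim_zeroLocus]
    refine ringKrullDim_eq_of_ringEquiv ?_
    refine ((Ideal.quotientEquivAlgOfEq ℤ ?_).toRingEquiv.trans
      (RingHom.quotientKerEquivOfSurjective
      (f := (Ideal.Quotient.mk p).comp (Ideal.Quotient.mk J))
      (Ideal.Quotient.mk_surjective.comp hsurj))).symm
    rw [← RingHom.comap_ker, Ideal.mk_ker]
  change (∀ Z ∈ irreducibleComponents (PrimeSpectrum (R ⧸ J)),
    ∀ Z' ∈ irreducibleComponents (PrimeSpectrum (R ⧸ J)),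
      topologicalKrullDim Z = topologicalKrullDim Z') ↔ _
  rw [← PrimeSpectrum.zeroLocus_minimalPrimes, hmin]
  simp only [Set.forall_mem_image, Function.comp_apply, hdim]

/-! ### Minors and linear independence -/

theorem Matrix.exists_submatrix_det_ne_zero {K α : Type*} [Field K] [Fintype α] {k : ℕ}
    (A : Matrix α (Fin k) K) (hA : LinearIndependent K A.col) :
    ∃ r : Fin k ↪ α, (A.submatrix r id).det ≠ 0 := by
  have hrank : Module.finrank K (Submodule.span K (Set.range A.row)) = k := by
    rw [← A.rank_eq_finrank_span_row, ← A.rank_transpose, LinearIndependent.rank_matrix]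
    · simp
    · exact hA
  obtain ⟨f, hf, -, hind⟩ := Submodule.exists_fun_fin_finrank_span_eq K (Set.range A.row)
  choose r hr using hf
  have hinj : Function.Injective r := fun a b hab => hind.injective (by rw [← hr, ← hr, hab])
  let e : Fin k ≃ Fin _ := finCongr hrank.symm
  refine ⟨e.toEmbedding.trans ⟨r, hinj⟩, ?_⟩
  have : LinearIndependent K (A.submatrix (e.toEmbedding.trans ⟨r, hinj⟩) id).row := by
    convert! hind.comp e e.injective using 1
    ext a b
    exact congrFun (hr (e a)) b
  rw [Matrix.linearIndependent_rows_iff_isUnit, Matrix.isUnit_iff_isUnit_det] at this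
  exact this.ne_zero

theorem Matrix.det_submatrix_mul_eq_zero {K α β γ : Type*} [Field K] [Fintype β] {k : ℕ}
    (hk : Fintype.card β < k) (V : Matrix α β K) (T : Matrix β γ K) (r : Fin k → α) (c : Fin k → γ) :
    ((V * T).submatrix r c).det = 0 := by
  by_contra h
  have h1 := Matrix.rank_of_det_ne_zero h
  rw [← Matrix.submatrix_mul_equiv V T r (Equiv.refl β) c] at h1
  have h2 := (Matrix.rank_mul_le_left (V.submatrix r (Equiv.refl β)) (T.submatrix (Equiv.refl β) c))
  have h3 := Matrix.rank_le_card_width (V.submatrix r (Equiv.refl β))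
  rw [Fintype.card_fin] at h1
  omega

/-! ### Points of the Hessenberg scheme over a field -/

/-- Evaluation of polynomials in the matrix entries at a matrix `Z`. -/
noncomputable def evalMatrix {n : ℕ} {S : Type*} [CommRing S] [Algebra ℂ S]
    (Z : Matrix (Fin n) (Fin n) S) : MatCoordRing n →ₐ[ℂ] S :=
  MvPolynomial.aeval fun p => Z p.1 p.2

@[simp]
theorem evalMatrix_X {n : ℕ} {S : Type*} [CommRing S] [Algebra ℂ S]
    (Z : Matrix (Fin n) (Fin n) S) (p : Fin n × Fin n) :
    evalMatrix Z (MvPolynomial.X p) = Z p.1 p.2 :=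
  MvPolynomial.aeval_X _ _

theorem evalMatrix_map {n : ℕ} {S T : Type*} [CommRing S] [Algebra ℂ S] [CommRing T] [Algebra ℂ T]
    (ψ : S →ₐ[ℂ] T) (Z : Matrix (Fin n) (Fin n) S) :
    evalMatrix (Z.map ψ) = ψ.comp (evalMatrix Z) := by
  ext p
  simp

theorem algHom_eq_evalMatrix {n : ℕ} {S : Type*} [CommRing S] [Algebra ℂ S]
    (φ : MatCoordRing n →ₐ[ℂ] S) : φ = evalMatrix ((genericMatrix n).map φ) := by
  ext p
  simp [Matrix.mvPolynomialX]

theorem mapMatrix_evalMatrix_genericMatrix {n : ℕ} {S : Type*} [CommRing S] [Algebra ℂ S]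
    (Z : Matrix (Fin n) (Fin n) S) : (evalMatrix Z).mapMatrix (genericMatrix n) = Z := by
  ext i j
  simp [Matrix.mvPolynomialX]

theorem evalMatrix_det {n : ℕ} {S : Type*} [CommRing S] [Algebra ℂ S]
    (Z : Matrix (Fin n) (Fin n) S) : evalMatrix Z (genericMatrix n).det = Z.det := by
  rw [AlgHom.map_det, mapMatrix_evalMatrix_genericMatrix]

theorem evalMatrix_adjugate {n : ℕ} {S : Type*} [CommRing S] [Algebra ℂ S]
    (Z : Matrix (Fin n) (Fin n) S) (i j : Fin n) :
    evalMatrix Z ((genericMatrix n).adjugate i j) = Z.adjugate i j := by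
  have h := AlgHom.map_adjugate (evalMatrix Z) (genericMatrix n)
  rw [mapMatrix_evalMatrix_genericMatrix] at h
  exact congrFun (congrFun h i) j

/-- The matrix `Z` has its first row supported in the columns `≥ r`, and `b`, supported in the
indices `≤ m`, is a solution of `Z b = e₁`. For invertible `Z` these are the conditions cutting out
the component of `r` if `m = h r`. -/
structure IsComponentPoint {n : ℕ} [NeZero n] {K : Type*} [CommRing K] (r m : Fin n)
    (Z : Matrix (Fin n) (Fin n) K) (b : Fin n → K) : Prop where
  row_eq_zero : ∀ j, j < r → Z 0 j = 0
  apply_eq_zero : ∀ k, m < k → b k = 0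
  mulVec_eq : Z.mulVec b = Pi.single 0 1

theorem minimalSemisimple_mul_apply {n : ℕ} [NeZero n] {S : Type*} [CommRing S] [Algebra ℂ S]
    (Z : Matrix (Fin n) (Fin n) S) (a j : Fin n) :
    evalMatrix Z (((minimalSemisimple n).map MvPolynomial.C * genericMatrix n :
      Matrix _ _ (MatCoordRing n)) a j) = (Pi.single 0 (Z 0 j) : Fin n → S) a := by
  have hmap : (minimalSemisimple n).map (MvPolynomial.C : ℂ →+* MatCoordRing n) =
      Matrix.diagonal fun i => if i = 0 then 1 else 0 := by
    rw [minimalSemisimple, Matrix.diagonal_map (map_zero _)]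
    congr 1
    ext1 i
    simp only [← Fin.val_eq_zero_iff]
    split_ifs <;> simp
  rw [hmap, Matrix.diagonal_mul, Pi.single_apply]
  split_ifs with h <;> simp [h]

theorem IsHessenberg.monotone {n : ℕ} {h : Fin n → Fin n} (hh : IsHessenberg h) : Monotone h := by
  rcases n with _ | n
  · exact fun i => i.elim0
  · exact Fin.monotone_iff_le_succ.mpr fun i => hh.mono _ _ (by simp)

/-- If `Z b = e₁`, then every column `z_{1j} e₁` of the Hessenberg matrix is `z_{1j} Z b`, a
combination of columns of `Z`, so that the minors in question vanish. -/
theorem IsComponentPoint.hessenbergIdeal_le_ker {n : ℕ} [NeZero n] {K : Type*} [Field K]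
    [Algebra ℂ K] {h : Fin n → Fin n} (hh : IsHessenberg h) {r : Fin n}
    {Z : Matrix (Fin n) (Fin n) K} {b : Fin n → K} (hZ : IsComponentPoint r (h r) Z b) :
    hessenbergIdeal (minimalSemisimple n) h ≤ RingHom.ker (evalMatrix Z) := by
  refine iSup_le fun i => ?_
  unfold hessenbergIdealAt
  split_ifs with hi
  · exact bot_le
  refine Ideal.span_le.mpr ?_
  rintro _ ⟨r', c, rfl⟩
  rw [SetLike.mem_coe, RingHom.mem_ker, AlgHom.map_det]
  let V : Matrix (Fin n) {j : Fin n // j ≤ h i} K := Z.submatrix id Subtype.val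
  let T : Matrix {j : Fin n // j ≤ h i} ({j : Fin n // j ≤ i} ⊕ {j : Fin n // j ≤ h i}) K :=
    Matrix.of fun k => Sum.elim (fun j => Z 0 j * b k) (fun j => if k = j then 1 else 0)
  have hM : (hessenbergMatrix (minimalSemisimple n) h i).map (evalMatrix Z) = V * T := by
    ext a (j | j)
    · have hl : (hessenbergMatrix (minimalSemisimple n) h i).map (evalMatrix Z) a (Sum.inl j) =
          (Pi.single 0 (Z 0 j) : Fin n → K) a := minimalSemisimple_mul_apply Z a j
      have hb : ∀ k, ¬ k ≤ h i → Z 0 j * b k = 0 := by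
        intro k hk
        rcases lt_or_ge j.1 r with hjr | hjr
        · simp [hZ.row_eq_zero _ hjr]
        · rw [hZ.apply_eq_zero k
            ((hh.monotone (hjr.trans j.2)).trans_lt (not_le.mp hk)), mul_zero]
      have hs : (V * T) a (Sum.inl j) = ∑ k, Z a k * (Z 0 j * b k) := by
        refine Fintype.sum_of_injective (Subtype.val : {k : Fin n // k ≤ h i} → Fin n)
          Subtype.val_injective _ _ (fun k hk => ?_) fun k => rfl
        rw [hb k (by simpa using hk), mul_zero]
      have hm := congrFun hZ.mulVec_eq a
      rw [Matrix.mulVec, dotProduct] at hm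
      rw [hl, hs]
      calc (Pi.single 0 (Z 0 j) : Fin n → K) a = Z 0 j * (Pi.single 0 1 : Fin n → K) a := by
            simp [Pi.single_apply]
        _ = _ := by
            rw [← hm, Finset.mul_sum]
            exact Finset.sum_congr rfl fun k _ => by ring
    · have hl : (hessenbergMatrix (minimalSemisimple n) h i).map (evalMatrix Z) a (Sum.inr j) =
          Z a j := by simp [hessenbergMatrix, Matrix.mvPolynomialX]
      rw [hl]
      simp [Matrix.mul_apply, V, T]
  change (((hessenbergMatrix (minimalSemisimple n) h i).map (evalMatrix Z)).submatrix r' c).det = 0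
  rw [hM]
  refine Matrix.det_submatrix_mul_eq_zero ?_ V T r' c
  rw [Fintype.card_subtype, Finset.filter_ge_eq_Iic, Fin.card_Iic]
  omega

/-- Conversely, over a field an invertible matrix in the zero locus of the Hessenberg ideal lies on
the component of the first column `r` with `z_{1r} ≠ 0`: the vanishing of the minors that involve
`z_{1r} e₁` puts `e₁` in the span of the columns `≤ h r`. -/
theorem exists_isComponentPoint {n : ℕ} [NeZero n] {K : Type*} [Field K]
    [Algebra ℂ K] {h : Fin n → Fin n} {Z : Matrix (Fin n) (Fin n) K} (hdet : Z.det ≠ 0)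
    (hI : hessenbergIdeal (minimalSemisimple n) h ≤ RingHom.ker (evalMatrix Z)) :
    ∃ r b, IsComponentPoint r (h r) Z b := by
  classical
  have hunit : IsUnit Z.det := hdet.isUnit
  have hex : ∃ j, Z 0 j ≠ 0 := by
    by_contra! hrow
    exact hdet (Matrix.det_eq_zero_of_row_eq_zero 0 hrow)
  let r := (Finset.univ.filter fun j => Z 0 j ≠ 0).min' ⟨hex.choose, by simp [hex.choose_spec]⟩
  have hr : Z 0 r ≠ 0 := by
    have := Finset.min'_mem (Finset.univ.filter fun j => Z 0 j ≠ 0)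
      ⟨hex.choose, by simp [hex.choose_spec]⟩
    simpa using this
  have hlt : ∀ j, j < r → Z 0 j = 0 := by
    intro j hj
    by_contra hne
    exact absurd (Finset.min'_le (Finset.univ.filter fun j => Z 0 j ≠ 0) j (by simp [hne]))
      (not_le.mpr hj)
  refine ⟨r, Z⁻¹.mulVec (Pi.single 0 1), hlt, ?_, ?_⟩
  · intro k hk
    by_contra hbk
    have hk' : (h r : ℕ) < k := hk
    have hle : (h r : ℕ) + 1 ≤ n := (h r).2
    let t : Fin ((h r : ℕ) + 1) → {j : Fin n // j ≤ h r} := fun s =>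
      ⟨⟨s, by omega⟩, Fin.le_def.mpr (by simpa using Nat.lt_succ_iff.mp s.2)⟩
    have ht : Function.Injective t := fun a b hab => by simpa [t, Fin.ext_iff] using hab
    let c : Fin ((h r : ℕ) + 2) → {j : Fin n // j ≤ r} ⊕ {j : Fin n // j ≤ h r} :=
      Fin.cons (Sum.inl ⟨r, le_rfl⟩) fun s => Sum.inr (t s)
    have hc : Function.Injective c := by
      refine Fin.cons_injective_iff.mpr ⟨by simp, fun a b hab => ht (by simpa using hab)⟩
    let A := ((hessenbergMatrix (minimalSemisimple n) h r).map (evalMatrix Z)).submatrix id c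
    have hcol : A.col = Fin.cons (Pi.single 0 (Z 0 r)) fun s => Z.col (t s) := by
      funext s
      refine Fin.cases ?_ (fun s => ?_) s
      · funext a
        exact minimalSemisimple_mul_apply Z a r
      · funext a
        simp [A, c, hessenbergMatrix, Matrix.mvPolynomialX, Matrix.col]
    have hind : LinearIndependent K A.col := by
      rw [hcol, linearIndependent_finCons]
      refine ⟨(Matrix.linearIndependent_cols_of_det_ne_zero hdet).comp (fun s => (t s).1)
        (Subtype.val_injective.comp ht), fun hmem => ?_⟩
      -- the `k`-th coordinate in the basis of columns of `Z`
      let ℓ : (Fin n → K) →ₗ[K] K := (LinearMap.proj k).comp Z⁻¹.mulVecLin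
      have hℓ : Submodule.span K (Set.range fun s => Z.col (t s).1) ≤ LinearMap.ker ℓ := by
        rw [Submodule.span_le]
        rintro _ ⟨s, rfl⟩
        have h1 : Z⁻¹.mulVec (Z.col (t s).1) = Pi.single (t s).1 1 := by
          rw [← Matrix.mulVec_single_one, Matrix.mulVec_mulVec, Matrix.nonsing_inv_mul _ hunit,
            Matrix.one_mulVec]
        have h2 : k ≠ (t s).1 := ((t s).2.trans_lt hk).ne'
        simp [ℓ, h1, h2]
      have h3 : Z⁻¹.mulVec (Pi.single 0 (Z 0 r)) k = 0 := hℓ hmem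
      have h4 : (Pi.single 0 (Z 0 r) : Fin n → K) = Z 0 r • Pi.single 0 1 := by
        simp [← Pi.single_smul]
      rw [h4, Matrix.mulVec_smul, Pi.smul_apply, smul_eq_mul] at h3
      exact (mul_ne_zero hr hbk) h3
    obtain ⟨r', hr'⟩ := A.exists_submatrix_det_ne_zero hind
    refine hr' ?_
    have hmem : ((hessenbergMatrix (minimalSemisimple n) h r).submatrix r' c).det ∈
        hessenbergIdeal (minimalSemisimple n) h := by
      refine (le_iSup (hessenbergIdealAt (minimalSemisimple n) h) r) ?_
      rw [hessenbergIdealAt, if_neg (by omega)]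
      exact Ideal.subset_span ⟨r', ⟨c, hc⟩, rfl⟩
    have h0 := hI hmem
    rw [RingHom.mem_ker, AlgHom.map_det] at h0
    exact h0
  · rw [Matrix.mulVec_mulVec, Matrix.mul_nonsing_inv _ hunit, Matrix.one_mulVec]

/-! ### A parametrization of the components -/

/-- The parameters of the component given by `r` and `m`: the entries `z_{1j}` with `r ≤ j`, the
coordinates `b_k`, `k ≤ m`, `k ≠ r`, of a solution of `Z b ∈ ⟨e₁⟩` normalized by `b_r = 1`, and the
entries `z_{ij}` with `i ≠ 1`, `j ≠ r`. -/
abbrev ComponentParam {n : ℕ} [NeZero n] (r m : Fin n) : Type :=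
  {j : Fin n // r ≤ j} ⊕
    ({k : Fin n // k ≤ m ∧ k ≠ r} ⊕ ({i : Fin n // i ≠ 0} × {j : Fin n // j ≠ r}))

/-- The generic point of the component given by `r` and `m`. Its entries in the column `r` below the
first row are determined by the others and by `b`. -/
noncomputable def componentMatrix {n : ℕ} [NeZero n] (r m : Fin n) :
    Matrix (Fin n) (Fin n) (MvPolynomial (ComponentParam r m) ℂ) :=
  Matrix.of fun i j =>
    if hi : i = 0 then
      if hj : r ≤ j then MvPolynomial.X (Sum.inl ⟨j, hj⟩) else 0
    else if hj : j = r then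
      -∑ k : {k : Fin n // k ≤ m ∧ k ≠ r},
        MvPolynomial.X (Sum.inr (Sum.inr (⟨i, hi⟩, ⟨k, k.2.2⟩))) *
          MvPolynomial.X (Sum.inr (Sum.inl k))
    else MvPolynomial.X (Sum.inr (Sum.inr (⟨i, hi⟩, ⟨j, hj⟩)))

/-- The vector `b`, normalized by `b_r = 1`, whose product with `componentMatrix r m` is a multiple
of `e₁`. -/
noncomputable def componentVector {n : ℕ} [NeZero n] (r m : Fin n) :
    Fin n → MvPolynomial (ComponentParam r m) ℂ :=
  fun k => if k = r then 1 else
    if hk : k ≤ m ∧ k ≠ r then MvPolynomial.X (Sum.inr (Sum.inl ⟨k, hk⟩)) else 0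

/-- The prime ideal of the component given by `r` and `m`. -/
noncomputable def componentIdeal {n : ℕ} [NeZero n] (r m : Fin n) : Ideal (MatCoordRing n) :=
  RingHom.ker (evalMatrix (componentMatrix r m))

instance {n : ℕ} [NeZero n] (r m : Fin n) : (componentIdeal r m).IsPrime :=
  RingHom.ker_isPrime _

/-- Splitting off the term of `r` in a sum over indices `≤ m`. -/
theorem sum_eq_add_sum_subtype {n : ℕ} {S : Type*} [CommRing S] {r m : Fin n} (f : Fin n → S)
    (hf : ∀ k, m < k → f k = 0) :
    ∑ k, f k = f r + ∑ k : {k : Fin n // k ≤ m ∧ k ≠ r}, f k := by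
  rw [Fintype.sum_eq_add_sum_compl r f]
  congr 1
  have h : ∑ k ∈ {r}ᶜ, f k = ∑ k : Fin n, if k ≠ r then f k else 0 := by
    rw [← Finset.sum_filter]
    exact Finset.sum_congr (by ext; simp) fun _ _ => rfl
  rw [h]
  refine (Fintype.sum_of_injective (Subtype.val : {k : Fin n // k ≤ m ∧ k ≠ r} → Fin n)
    Subtype.val_injective _ _ (fun k hk => ?_) fun k => ?_).symm
  · by_cases hkr : k = r
    · simp [hkr]
    · rw [if_pos hkr]
      exact hf k (not_le.mp fun hkm => hk ⟨⟨k, hkm, hkr⟩, rfl⟩)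
  · rw [if_pos k.2.2]

section

variable {n : ℕ} [NeZero n] {r m : Fin n}

theorem componentMatrix_zero_of_le {j : Fin n} (hj : r ≤ j) :
    componentMatrix r m 0 j = MvPolynomial.X (Sum.inl ⟨j, hj⟩) := by
  simp [componentMatrix, hj]

theorem componentMatrix_zero_of_lt {j : Fin n} (hj : j < r) : componentMatrix r m 0 j = 0 := by
  simp [componentMatrix, not_le.mpr hj]

theorem componentMatrix_of_ne {i j : Fin n} (hi : i ≠ 0) (hj : j ≠ r) :
    componentMatrix r m i j = MvPolynomial.X (Sum.inr (Sum.inr (⟨i, hi⟩, ⟨j, hj⟩))) := by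
  simp [componentMatrix, hi, hj]

theorem componentMatrix_self {i : Fin n} (hi : i ≠ 0) :
    componentMatrix r m i r = -∑ k : {k : Fin n // k ≤ m ∧ k ≠ r},
      MvPolynomial.X (Sum.inr (Sum.inr (⟨i, hi⟩, ⟨k, k.2.2⟩))) *
        MvPolynomial.X (Sum.inr (Sum.inl k)) := by
  simp [componentMatrix, hi]

theorem componentVector_self : componentVector r m r = 1 := if_pos rfl

theorem componentVector_of_le (k : {k : Fin n // k ≤ m ∧ k ≠ r}) :
    componentVector r m k = MvPolynomial.X (Sum.inr (Sum.inl k)) := by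
  simp [componentVector, k.2.1, k.2.2]

theorem componentVector_of_lt (hrm : r ≤ m) {k : Fin n} (hk : m < k) :
    componentVector r m k = 0 := by
  simp [componentVector, not_le.mpr hk, (hrm.trans_lt hk).ne']

theorem componentVector_ne_zero {k : Fin n} (hk : k ≤ m) : componentVector r m k ≠ 0 := by
  by_cases hkr : k = r
  · rw [hkr, componentVector_self]
    exact one_ne_zero
  · rw [componentVector_of_le ⟨k, hk, hkr⟩]
    exact MvPolynomial.X_ne_zero _

theorem componentMatrix_mulVec (hrm : r ≤ m) :
    (componentMatrix r m).mulVec (componentVector r m) =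
      Pi.single 0 ((componentMatrix r m).mulVec (componentVector r m) 0) := by
  funext i
  by_cases hi : i = 0
  · subst hi
    simp
  rw [Pi.single_eq_of_ne hi, Matrix.mulVec, dotProduct, sum_eq_add_sum_subtype _ fun k hk => by
    rw [componentVector_of_lt hrm hk, mul_zero]]
  rw [componentVector_self, mul_one, componentMatrix_self hi, neg_add_eq_zero]
  refine Finset.sum_congr rfl fun k _ => ?_
  rw [componentMatrix_of_ne hi k.2.2, componentVector_of_le]

/-- The determinant is nonzero since the generic point specializes to a permutation matrix. -/
theorem componentMatrix_det_ne_zero : (componentMatrix r m).det ≠ 0 := by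
  intro h0
  let e : ComponentParam r m → ℂ := Sum.elim (fun j => if j.1 = r then 1 else 0)
    (Sum.elim 0 fun p => if p.1.1 = Equiv.swap 0 r p.2.1 then 1 else 0)
  have hP : (MvPolynomial.aeval e).mapMatrix (componentMatrix r m) =
      (1 : Matrix (Fin n) (Fin n) ℂ).submatrix id (Equiv.swap 0 r) := by
    ext i j
    rw [AlgHom.mapMatrix_apply, Matrix.map_apply, Matrix.submatrix_apply, id_eq, Matrix.one_apply]
    by_cases hi : i = 0
    · subst hi
      rcases le_or_gt r j with hj | hj
      · have : 0 = Equiv.swap 0 r j ↔ j = r := by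
          rw [eq_comm, Equiv.swap_apply_eq_iff, Equiv.swap_apply_left]
        simp [componentMatrix_zero_of_le hj, e, this]
      · have : ¬ 0 = Equiv.swap 0 r j := by
          rw [eq_comm, Equiv.swap_apply_eq_iff, Equiv.swap_apply_left]
          exact hj.ne
        simp [componentMatrix_zero_of_lt hj, this]
    · by_cases hj : j = r
      · subst hj
        simp [componentMatrix_self hi, e, hi]
      · simp [componentMatrix_of_ne hi hj, e]
  have h1 := congrArg (MvPolynomial.aeval e) h0
  rw [AlgHom.map_det, hP, Matrix.det_permute', map_zero] at h1
  simp at h1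

theorem componentMatrix_adjugate (hrm : r ≤ m) (k : Fin n) :
    (componentMatrix r m).adjugate k 0 * (componentMatrix r m).mulVec (componentVector r m) 0 =
      (componentMatrix r m).det * componentVector r m k := by
  have h := congrArg (componentMatrix r m).adjugate.mulVec (componentMatrix_mulVec hrm)
  rw [Matrix.mulVec_mulVec, Matrix.adjugate_mul, Matrix.smul_mulVec, Matrix.one_mulVec] at h
  have hk := congrFun h k
  rw [Pi.smul_apply, smul_eq_mul] at hk
  rw [hk]
  simp

theorem componentMatrix_mulVec_zero_ne_zero (hrm : r ≤ m) :
    (componentMatrix r m).mulVec (componentVector r m) 0 ≠ 0 := by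
  intro h0
  have h := componentMatrix_adjugate hrm r
  rw [h0, mul_zero, componentVector_self, mul_one] at h
  exact componentMatrix_det_ne_zero h.symm

theorem det_notMem_componentIdeal : (genericMatrix n).det ∉ componentIdeal r m := by
  rw [componentIdeal, RingHom.mem_ker, evalMatrix_det]
  exact componentMatrix_det_ne_zero

theorem X_mem_componentIdeal_iff {j : Fin n} :
    MvPolynomial.X (0, j) ∈ componentIdeal r m ↔ j < r := by
  rw [componentIdeal, RingHom.mem_ker, evalMatrix_X]
  rcases le_or_gt r j with hj | hj
  · simp [componentMatrix_zero_of_le hj, MvPolynomial.X_ne_zero, hj]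
  · simp [componentMatrix_zero_of_lt hj, hj]

theorem adjugate_mem_componentIdeal_iff (hrm : r ≤ m) {k : Fin n} :
    (genericMatrix n).adjugate k 0 ∈ componentIdeal r m ↔ m < k := by
  rw [componentIdeal, RingHom.mem_ker, evalMatrix_adjugate]
  have h := componentMatrix_adjugate hrm k
  constructor
  · intro h0
    by_contra hk
    rw [h0, zero_mul, zero_eq_mul] at h
    exact h.elim componentMatrix_det_ne_zero (componentVector_ne_zero (not_lt.mp hk))
  · intro hk
    rw [componentVector_of_lt hrm hk, mul_zero, mul_eq_zero] at h
    exact h.resolve_right (componentMatrix_mulVec_zero_ne_zero hrm)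

theorem le_of_componentIdeal_le {r' m' : Fin n} (hrm : r ≤ m) (hrm' : r' ≤ m')
    (h : componentIdeal r' m' ≤ componentIdeal r m) : r' ≤ r ∧ m ≤ m' := by
  constructor
  · by_contra! hlt
    exact lt_irrefl _ (X_mem_componentIdeal_iff.mp (h (X_mem_componentIdeal_iff.mpr hlt)))
  · by_contra! hlt
    exact lt_irrefl _ ((adjugate_mem_componentIdeal_iff hrm).mp
      (h ((adjugate_mem_componentIdeal_iff hrm').mpr hlt)))

theorem hessenbergIdeal_le_componentIdeal {h : Fin n → Fin n} (hh : IsHessenberg h) (r : Fin n) :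
    hessenbergIdeal (minimalSemisimple n) h ≤ componentIdeal r (h r) := by
  let S := MvPolynomial (ComponentParam r (h r)) ℂ
  let K := FractionRing S
  have hinj : Function.Injective (algebraMap S K) := IsFractionRing.injective S K
  have hrm := hh.le_apply r
  set α : S := (componentMatrix r (h r)).mulVec (componentVector r (h r)) 0 with hα
  have hα0 : algebraMap S K α ≠ 0 :=
    (map_ne_zero_iff _ hinj).mpr (componentMatrix_mulVec_zero_ne_zero hrm)
  have hZ : IsComponentPoint r (h r) ((componentMatrix r (h r)).map (algebraMap S K))
      ((algebraMap S K α)⁻¹ • (algebraMap S K ∘ componentVector r (h r))) := by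
    refine ⟨fun j hj => by simp [componentMatrix_zero_of_lt hj],
      fun k hk => by simp [componentVector_of_lt hrm hk], ?_⟩
    rw [Matrix.mulVec_smul]
    funext i
    rw [Pi.smul_apply, ← RingHom.map_mulVec, componentMatrix_mulVec hrm, ← hα]
    by_cases hi : i = 0
    · subst hi
      simpa using inv_mul_cancel₀ hα0
    · simp [hi]
  intro f hf
  have h1 := hZ.hessenbergIdeal_le_ker hh hf
  have h2 : evalMatrix ((componentMatrix r (h r)).map (algebraMap S K)) f =
      algebraMap S K (evalMatrix (componentMatrix r (h r)) f) := by
    exact DFunLike.congr_fun (evalMatrix_map (IsScalarTower.toAlgHom ℂ S K) _) f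
  rw [RingHom.mem_ker, h2] at h1
  exact hinj (h1.trans (map_zero _).symm)

/-- Where `b_r ≠ 0`, a point is the specialization of the generic point that is given by its own
entries and by the coordinates of `b / b_r`. -/
theorem componentIdeal_le_ker_of_ne_zero {K : Type*} [Field K] [Algebra ℂ K] (hrm : r ≤ m)
    {Z : Matrix (Fin n) (Fin n) K} {b : Fin n → K} (hZ : IsComponentPoint r m Z b)
    (hb : b r ≠ 0) : componentIdeal r m ≤ RingHom.ker (evalMatrix Z) := by
  let e : ComponentParam r m → K := Sum.elim (fun j => Z 0 j)
    (Sum.elim (fun k => b k / b r) fun p => Z p.1 p.2)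
  have he : Z = (componentMatrix r m).map (MvPolynomial.aeval e) := by
    ext i j
    rw [Matrix.map_apply]
    by_cases hi : i = 0
    · subst hi
      rcases le_or_gt r j with hj | hj
      · simp [componentMatrix_zero_of_le hj, e]
      · simp [componentMatrix_zero_of_lt hj, hZ.row_eq_zero j hj]
    · by_cases hj : j = r
      · subst hj
        have h := congrFun hZ.mulVec_eq i
        rw [Pi.single_eq_of_ne hi, Matrix.mulVec, dotProduct,
          sum_eq_add_sum_subtype _ fun k hk => by rw [hZ.apply_eq_zero k hk, mul_zero]] at h
        simp only [componentMatrix_self hi, map_neg, map_sum, map_mul, MvPolynomial.aeval_X, e,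
          Sum.elim_inr, Sum.elim_inl, mul_div_assoc', ← Finset.sum_div]
        rw [eq_neg_iff_add_eq_zero]
        field_simp
        simpa using h
      · simp [componentMatrix_of_ne hi hj, e]
  intro f hf
  rw [RingHom.mem_ker, he, evalMatrix_map, AlgHom.comp_apply, (RingHom.mem_ker).mp hf, map_zero]

open Polynomial in
/-- If `b_r = 0`, some other `b_j` with `r ≤ j ≤ m` is nonzero, and multiplication with the
transvections `1 + t e_{rj}` moves `Z` on a line whose other points are reached by the
parametrization. -/
theorem IsComponentPoint.componentIdeal_le_ker {K : Type*} [Field K] [Algebra ℂ K] (hrm : r ≤ m)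
    {Z : Matrix (Fin n) (Fin n) K} {b : Fin n → K} (hZ : IsComponentPoint r m Z b) :
    componentIdeal r m ≤ RingHom.ker (evalMatrix Z) := by
  have : CharZero K := charZero_of_injective_algebraMap (algebraMap ℂ K).injective
  have : Infinite K := CharZero.infinite K
  obtain ⟨j, hrj, hbj⟩ : ∃ j, r ≤ j ∧ b j ≠ 0 := by
    by_contra! hall
    have h := congrFun hZ.mulVec_eq 0
    rw [Pi.single_eq_same, Matrix.mulVec, dotProduct, Finset.sum_eq_zero] at h
    · exact zero_ne_one h
    · intro k _
      rcases le_or_gt r k with hk | hk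
      · rw [hall k hk, mul_zero]
      · rw [hZ.row_eq_zero k hk, zero_mul]
  by_cases hjr : r = j
  · subst hjr
    exact componentIdeal_le_ker_of_ne_zero hrm hZ hbj
  intro f hf
  rw [RingHom.mem_ker]
  let q : K[X] := evalMatrix (Z.map C * Matrix.transvection r j X) f
  have hq (t : K) : q.eval t = evalMatrix (Z * Matrix.transvection r j t) f := by
    have hmap : (Z.map C * Matrix.transvection r j X).map ((aeval t).restrictScalars ℂ) =
        Z * Matrix.transvection r j t := by
      ext a c
      by_cases hc : c = j
      · subst hc
        simpa using! mul_comm _ _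
      · simp [Matrix.mul_transvection_apply_of_ne _ _ _ _ hc]
    rw [← hmap, evalMatrix_map, AlgHom.comp_apply, AlgHom.restrictScalars_apply, coe_aeval_eq_eval]
  have hmul (t : K) : (Matrix.transvection r j t).mulVec b = b + Pi.single r (t * b j) := by
    rw [Matrix.transvection, Matrix.add_mulVec, Matrix.one_mulVec, Matrix.single_mulVec]
    rfl
  have hzero : ∀ t, t ≠ b r / b j → q.eval t = 0 := by
    intro t ht
    rw [hq]
    refine componentIdeal_le_ker_of_ne_zero hrm
      (b := (Matrix.transvection r j (-t)).mulVec b) ⟨?_, ?_, ?_⟩ ?_ hf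
    · intro c hc
      have : c ≠ j := (hc.trans_le hrj).ne
      rw [Matrix.mul_transvection_apply_of_ne _ _ _ _ this, hZ.row_eq_zero c hc]
    · intro k hk
      simp [hmul, hZ.apply_eq_zero k hk, (hrm.trans_lt hk).ne']
    · rw [Matrix.mulVec_mulVec, Matrix.mul_assoc, Matrix.transvection_mul_transvection_same r j hjr,
        add_neg_cancel, Matrix.transvection_zero, mul_one, hZ.mulVec_eq]
    · rw [hmul, Pi.add_apply, Pi.single_eq_same]
      intro h0
      apply ht
      rw [eq_div_iff hbj]
      linear_combination -h0
  have hq0 : q = 0 := by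
    refine Polynomial.eq_zero_of_infinite_isRoot q ?_
    exact (Set.Finite.infinite_compl (Set.finite_singleton (b r / b j))).mono hzero
  have := hq 0
  rwa [hq0, eval_zero, Matrix.transvection_zero, mul_one, eq_comm] at this

end

/-! ### Dimension of the components -/

theorem card_componentParam_add {n : ℕ} [NeZero n] {r m : Fin n} (hrm : r ≤ m) :
    Fintype.card (ComponentParam r m) + r = n + m + (n - 1) * (n - 1) := by
  have h1 : Fintype.card {j : Fin n // r ≤ j} = n - r := by
    rw [Fintype.card_subtype, Finset.filter_le_eq_Ici, Fin.card_Ici]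
  have h2 : Fintype.card {k : Fin n // k ≤ m ∧ k ≠ r} = m := by
    have : Finset.univ.filter (fun k : Fin n => k ≤ m ∧ k ≠ r) = (Finset.Iic m).erase r := by
      ext k
      simp [and_comm]
    rw [Fintype.card_subtype, this, Finset.card_erase_of_mem (Finset.mem_Iic.mpr hrm), Fin.card_Iic,
      Nat.add_sub_cancel]
  have h3 (i : Fin n) : Fintype.card {j : Fin n // j ≠ i} = n - 1 := by
    simp
  rw [Fintype.card_sum, Fintype.card_sum, Fintype.card_prod, h1, h2, h3, h3]
  have := r.2
  omega

/-- By Cramer's rule `det A • x` is a polynomial expression in the entries of `A` and of `A x`. -/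
theorem Matrix.isAlgebraic_of_mulVec {R S β : Type*} [CommRing R] [IsDomain R] [CommRing S]
    [IsDomain S] [Algebra R S] [Fintype β] [DecidableEq β] {A : Matrix β β S}
    (hdet : A.det ≠ 0) {x : β → S} (hA : ∀ i j, A i j ∈ (algebraMap R S).range)
    (hx : ∀ i, A.mulVec x i ∈ (algebraMap R S).range) (k : β) : IsAlgebraic R (x k) := by
  choose A' hA' using hA
  choose y' hy' using hx
  have hA₁ : A = (algebraMap R S).mapMatrix (Matrix.of A') := by
    ext i j
    exact (hA' i j).symm
  have hy₁ : A.mulVec x = algebraMap R S ∘ y' := funext fun i => (hy' i).symm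
  have h := congrFun (congrArg A.adjugate.mulVec hy₁) k
  rw [Matrix.mulVec_mulVec, Matrix.adjugate_mul, Matrix.smul_mulVec, Matrix.one_mulVec,
    Pi.smul_apply, smul_eq_mul] at h
  have hdet' : A.det = algebraMap R S (Matrix.of A').det := by
    rw [hA₁, RingHom.map_det]
  have hadj : A.adjugate.mulVec (algebraMap R S ∘ y') k =
      algebraMap R S ((Matrix.of A').adjugate.mulVec y' k) := by
    rw [hA₁, ← RingHom.map_adjugate, RingHom.map_mulVec]
    rfl
  refine IsAlgebraic.of_mul (y := A.det) (mem_nonZeroDivisors_of_ne_zero hdet) ?_ ?_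
  · rw [hdet']
    exact isAlgebraic_algebraMap _
  · rw [h, hadj]
    exact isAlgebraic_algebraMap _

theorem ringKrullDim_quotient_componentIdeal {n : ℕ} [NeZero n] {r m : Fin n} :
    ringKrullDim (MatCoordRing n ⧸ componentIdeal r m) = Fintype.card (ComponentParam r m) := by
  refine ringKrullDim_quotient_ker_eq_card (evalMatrix (componentMatrix r m)) ?_
  set A := (evalMatrix (componentMatrix r m)).range with hA
  have hmem (i j : Fin n) : componentMatrix r m i j ∈ (algebraMap A
      (MvPolynomial (ComponentParam r m) ℂ)).range :=
    ⟨⟨_, ⟨MvPolynomial.X (i, j), evalMatrix_X _ _⟩⟩, rfl⟩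
  have hXmem {s : ComponentParam r m} {i j : Fin n}
      (h : componentMatrix r m i j = MvPolynomial.X s) :
      IsAlgebraic A (MvPolynomial.X s : MvPolynomial (ComponentParam r m) ℂ) := by
    obtain ⟨a, ha⟩ := hmem i j
    rw [← h, ← ha]
    exact isAlgebraic_algebraMap a
  rintro (j | k | p)
  · exact hXmem (componentMatrix_zero_of_le j.2)
  · -- the `b_k` solve as many of the equations below the first row as there are unknowns
    obtain ⟨e⟩ : Nonempty ({k : Fin n // k ≤ m ∧ k ≠ r} ↪ {i : Fin n // i ≠ 0}) := by
      refine (Function.Embedding.nonempty_of_card_le ?_)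
      calc Fintype.card {k : Fin n // k ≤ m ∧ k ≠ r} ≤ Fintype.card {k : Fin n // k ≠ r} :=
            Fintype.card_subtype_mono _ _ fun k hk => hk.2
        _ = Fintype.card {i : Fin n // i ≠ 0} := by simp
    let B := {k : Fin n // k ≤ m ∧ k ≠ r}
    let M : Matrix B B (MvPolynomial (ComponentParam r m) ℂ) :=
      Matrix.of fun i k => componentMatrix r m (e i) k
    let f : B × B → ComponentParam r m := fun p => Sum.inr (Sum.inr (e p.1, ⟨p.2, p.2.2.2⟩))
    have hf : Function.Injective f := by
      rintro ⟨i, j⟩ ⟨i', j'⟩ h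
      simp only [f, Sum.inr.injEq, Prod.mk.injEq, EmbeddingLike.apply_eq_iff_eq,
        Subtype.mk.injEq] at h
      exact Prod.ext h.1 (Subtype.ext h.2)
    have hM : M = (MvPolynomial.rename f).mapMatrix (Matrix.mvPolynomialX B B ℂ) := by
      ext1 i j
      simp [M, f, componentMatrix_of_ne (e i).2 j.2.2]
    have hdet : M.det ≠ 0 := by
      rw [hM, ← AlgHom.map_det]
      exact (map_ne_zero_iff _ (MvPolynomial.rename_injective f hf)).mpr
        (Matrix.det_mvPolynomialX_ne_zero B ℂ)
    refine Matrix.isAlgebraic_of_mulVec (R := A) hdet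
      (x := fun k => MvPolynomial.X (Sum.inr (Sum.inl k))) (fun i j => hmem _ _) (fun i => ?_) k
    have : M.mulVec (fun k => MvPolynomial.X (Sum.inr (Sum.inl k))) i =
        -componentMatrix r m (e i) r := by
      rw [componentMatrix_self (e i).2, neg_neg, Matrix.mulVec, dotProduct]
      refine Finset.sum_congr rfl fun k _ => ?_
      simp [M, componentMatrix_of_ne (e i).2 k.2.2]
    rw [this]
    exact neg_mem (hmem _ _)
  · exact hXmem (componentMatrix_of_ne p.1.2 p.2.2)

/-! ### Minimal primes of the Hessenberg ideal -/

theorem detSaturation_le_iff {n : ℕ} {I P : Ideal (MatCoordRing n)} [P.IsPrime]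
    (hP : (genericMatrix n).det ∉ P) : detSaturation I ≤ P ↔ I ≤ P := by
  refine ⟨Ideal.le_comap_map.trans, fun hI => ?_⟩
  have hdisj : Disjoint (Submonoid.powers (genericMatrix n).det : Set (MatCoordRing n)) P :=
    (Ideal.disjoint_powers_iff_notMem _ (Ideal.IsPrime.isRadical ‹_›)).mpr hP
  refine (Ideal.comap_mono (Ideal.map_mono hI)).trans_eq ?_
  exact IsLocalization.under_map_of_isPrime_disjoint (Submonoid.powers (genericMatrix n).det)
    (Localization.Away (genericMatrix n).det) ‹_› hdisj

theorem det_notMem_of_mem_minimalPrimes_detSaturation {n : ℕ} {I q : Ideal (MatCoordRing n)}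
    (hq : q ∈ (detSaturation I).minimalPrimes) : (genericMatrix n).det ∉ q := by
  obtain ⟨Q, hQ, rfl⟩ := Ideal.exists_minimalPrimes_comap_eq _ q hq
  intro hmem
  exact hQ.isPrime.ne_top (Ideal.eq_top_of_isUnit_mem _ hmem
    (IsLocalization.Away.algebraMap_isUnit (genericMatrix n).det))

theorem exists_isHessenbergCorner {n : ℕ} {h : Fin n → Fin n} (hh : IsHessenberg h) (r : Fin n) :
    ∃ s, IsHessenbergCorner h s ∧ s ≤ r ∧ h s = h r := by
  obtain ⟨k, hk⟩ := r
  induction k with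
  | zero => exact ⟨⟨0, hk⟩, fun j hj => by simp at hj, le_rfl, rfl⟩
  | succ k ih =>
    by_cases hc : h ⟨k, by omega⟩ = h ⟨k + 1, hk⟩
    · obtain ⟨s, hs, hle, heq⟩ := ih (by omega)
      exact ⟨s, hs, hle.trans (Fin.le_def.mpr (by simp)), heq.trans hc⟩
    · refine ⟨⟨k + 1, hk⟩, fun j hj => ?_, le_rfl, rfl⟩
      rw [show j = ⟨k, by omega⟩ from Fin.ext (by simpa using hj)]
      exact lt_of_le_of_ne (hh.mono _ _ rfl) hc

theorem IsHessenbergCorner.apply_lt {n : ℕ} {h : Fin n → Fin n} (hh : IsHessenberg h) {s r : Fin n}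
    (hr : IsHessenbergCorner h r) (hsr : s < r) : h s < h r := by
  have hlt : (s : ℕ) < r := hsr
  refine (hh.monotone (b := ⟨(r : ℕ) - 1, by omega⟩) ?_).trans_lt (hr _ ?_)
  · exact Fin.le_def.mpr (Nat.le_sub_one_of_lt hlt)
  · exact Nat.sub_add_cancel (by omega)

/-- Every point of the Hessenberg scheme over an invertible matrix lies on one of the components. -/
theorem exists_componentIdeal_le {n : ℕ} [NeZero n] {h : Fin n → Fin n} (hh : IsHessenberg h)
    {q : Ideal (MatCoordRing n)} [q.IsPrime] (hdet : (genericMatrix n).det ∉ q)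
    (hI : hessenbergIdeal (minimalSemisimple n) h ≤ q) :
    ∃ r, IsHessenbergCorner h r ∧ componentIdeal r (h r) ≤ q := by
  let φ : MatCoordRing n →ₐ[ℂ] FractionRing (MatCoordRing n ⧸ q) :=
    (IsScalarTower.toAlgHom ℂ (MatCoordRing n ⧸ q) _).comp (Ideal.Quotient.mkₐ ℂ q)
  have hker : RingHom.ker φ = q := by
    ext f
    rw [RingHom.mem_ker]
    change algebraMap (MatCoordRing n ⧸ q) (FractionRing (MatCoordRing n ⧸ q))
      (Ideal.Quotient.mk q f) = 0 ↔ _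
    rw [map_eq_zero_iff _ (IsFractionRing.injective _ _), Ideal.Quotient.eq_zero_iff_mem]
  set Z := (genericMatrix n).map φ
  have hφ : φ = evalMatrix Z := algHom_eq_evalMatrix φ
  rw [hφ] at hker
  rw [← hker, RingHom.mem_ker, evalMatrix_det] at hdet
  rw [← hker] at hI
  obtain ⟨r, b, hZ⟩ := exists_isComponentPoint hdet hI
  obtain ⟨s, hs, hsr, heq⟩ := exists_isHessenbergCorner hh r
  have hZs : IsComponentPoint s (h s) Z b :=
    ⟨fun j hj => hZ.row_eq_zero j (hj.trans_le hsr), heq ▸ hZ.apply_eq_zero, hZ.mulVec_eq⟩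
  exact ⟨s, hs, hker ▸ hZs.componentIdeal_le_ker (hh.le_apply s)⟩

theorem minimalPrimes_detSaturation_hessenbergIdeal {n : ℕ} [NeZero n] {h : Fin n → Fin n}
    (hh : IsHessenberg h) :
    (detSaturation (hessenbergIdeal (minimalSemisimple n) h)).minimalPrimes =
      {p | ∃ r, IsHessenbergCorner h r ∧ p = componentIdeal r (h r)} := by
  set J := detSaturation (hessenbergIdeal (minimalSemisimple n) h)
  have hJ (r : Fin n) : J ≤ componentIdeal r (h r) :=
    (detSaturation_le_iff det_notMem_componentIdeal).mpr (hessenbergIdeal_le_componentIdeal hh r)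
  have hex {q : Ideal (MatCoordRing n)} (hq : q ∈ J.minimalPrimes) :
      ∃ r, IsHessenbergCorner h r ∧ componentIdeal r (h r) ≤ q := by
    have := hq.isPrime
    have hdet := det_notMem_of_mem_minimalPrimes_detSaturation hq
    exact exists_componentIdeal_le hh hdet ((detSaturation_le_iff hdet).mp hq.le)
  ext q
  constructor
  · intro hq
    obtain ⟨r, hr, hle⟩ := hex hq
    exact ⟨r, hr, le_antisymm (hq.2 ⟨inferInstance, hJ r⟩ hle) hle⟩
  · rintro ⟨r, hr, rfl⟩
    obtain ⟨q, hq, hqr⟩ := Ideal.exists_minimalPrimes_le (hJ r)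
    obtain ⟨s, hs, hle⟩ := hex hq
    obtain ⟨hsr, hrs⟩ := le_of_componentIdeal_le (hh.le_apply r) (hh.le_apply s) (hle.trans hqr)
    obtain rfl : s = r := by
      refine hsr.eq_of_not_lt fun hlt => ?_
      exact (hr.apply_lt hh hlt).not_ge hrs
    rwa [le_antisymm hle hqr]

theorem isEquidimensional_matrixHessenbergScheme_iff {n : ℕ} [NeZero n] {h : Fin n → Fin n}
    (hh : IsHessenberg h) :
    IsEquidimensional (matrixHessenbergScheme (minimalSemisimple n) h) ↔
      ∀ i j : Fin n, IsHessenbergCorner h i → IsHessenbergCorner h j →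
        ((h i : ℕ) : ℤ) - ((i : ℕ) : ℤ) = ((h j : ℕ) : ℤ) - ((j : ℕ) : ℤ) := by
  have hdim (i j : Fin n) :
      ringKrullDim (MatCoordRing n ⧸ componentIdeal i (h i)) =
        ringKrullDim (MatCoordRing n ⧸ componentIdeal j (h j)) ↔
      ((h i : ℕ) : ℤ) - ((i : ℕ) : ℤ) = ((h j : ℕ) : ℤ) - ((j : ℕ) : ℤ) := by
    rw [ringKrullDim_quotient_componentIdeal, ringKrullDim_quotient_componentIdeal, Nat.cast_inj]
    have hi := card_componentParam_add (hh.le_apply i)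
    have hj := card_componentParam_add (hh.le_apply j)
    omega
  rw [matrixHessenbergScheme, isEquidimensional_Spec_quotient_iff,
    minimalPrimes_detSaturation_hessenbergIdeal hh]
  constructor
  · intro H i j hi hj
    exact (hdim i j).mp (H _ ⟨i, hi, rfl⟩ _ ⟨j, hj, rfl⟩)
  · rintro H _ ⟨i, hi, rfl⟩ _ ⟨j, hj, rfl⟩
    exact (hdim i j).mpr (H i j hi hj)

theorem mainTheorem4 (n : ℕ) (hn : 0 < n) (h : Fin n → Fin n) (hh : IsHessenberg h) :
    (IsEquidimensional (matrixHessenbergScheme (minimalSemisimple n) h) ↔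
      ∀ i j : Fin n, IsHessenbergCorner h i → IsHessenbergCorner h j →
        ((h i : ℕ) : ℤ) - ((i : ℕ) : ℤ) = ((h j : ℕ) : ℤ) - ((j : ℕ) : ℤ)) ∧
    (IsEquidimensional (matrixHessenbergScheme (minimalSemisimple n) h) ↔
      ∃ k : ℕ, cornerBoxes h ⊆ subdiagonal n k) := by
  have : NeZero n := ⟨hn.ne'⟩
  have hiff := isEquidimensional_matrixHessenbergScheme_iff hh
  refine ⟨hiff, hiff.trans ⟨fun H => ?_, ?_⟩⟩
  · have h0 : IsHessenbergCorner h 0 := fun j hj => by simp at hj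
    refine ⟨h 0, ?_⟩
    rintro _ ⟨i, hi, rfl⟩
    have := H i 0 hi h0
    simpa [subdiagonal] using this
  · rintro ⟨k, hk⟩ i j hi hj
    have h1 : ((h i : ℕ) : ℤ) - ((i : ℕ) : ℤ) = k := hk ⟨i, hi, rfl⟩
    have h2 : ((h j : ℕ) : ℤ) - ((j : ℕ) : ℤ) = k := hk ⟨j, hj, rfl⟩
    rw [h1, h2]
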